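/- **Weak Maximum Principle for a mixed Dirichlet–Neumann problem.** Let $\Omega\subset\mathbb{R}^n$ be a bounded connected open set with Lipschitz boundary $\partial\Omega$, let $\Gamma\subset\partial\Omega$ be nonempty and relatively open in $\partial\Omega$, and let $\sigma\in L^\infty_+(\Omega)$, i.e. $\sigma$ is measurable and there is $\lambda\in(0,1)$ with $\lambda\le\sigma\le\lambda^{-1}$ a.e. in $\Omega$. Let $H^1_{0,\Gamma}(\Omega)$ be the set of functions in $H^1(\Omega)$ whose trace on $\partial\Omega$ vanishes a.e. on $\Gamma$ with respect to the $(n-1)$-dimensional surface measure. Let $u\in H^1(\Omega)\cap C(\overline\Omega)$ be a weak solution of $$-\nabla\cdot(\sigma\nabla u)=0\ \text{ in }\Omega,\qquad \sigma\,\partial_\nu u=0\ \text{ on }\partial\Omega\setminus\Gamma,$$ in the sense that $$\int_\Omega \sigma\,\nabla u\cdot\nabla v\,\mathrm{d}x=0\qquad\text{for all } v\in H^1_{0,\Gamma}(\Omega).$$ Then: 1. If $u\ge 0$ on $\Gamma$, then $u\ge 0$ in $\Omega$. 2. $\inf_{y\in\Gamma}u(y)\le u(x)\le\sup_{y\in\Gamma}u(y)$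 for all $x\in\Omega$. -/

import Mathlib

open MeasureTheory Filter Topology
open scoped ContDiff NNReal RealInnerProductSpace

noncomputable section

namespace MixedProblem

/-- `ℝⁿ` with its Euclidean norm. -/
abbrev Space (n : ℕ) : Type := EuclideanSpace ℝ (Fin n)

/-- The boundary of `Ω` is Lipschitz: near each boundary point `p` there are a unit vector `e` (the
vertical direction) and a Lipschitz function `γ` on the hyperplane orthogonal to `e` such that, in
a neighbourhood of `p`, the set `Ω` is exactly the part lying strictly above the graph of `γ`. -/
def HasLipschitzBoundary {n : ℕ} (Ω : Set (Space n)) : Prop :=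
  ∀ p ∈ frontier Ω, ∃ (e : Space n) (K : ℝ≥0) (γ : (ℝ ∙ e)ᗮ → ℝ) (U : Set (Space n)),
    ‖e‖ = 1 ∧ LipschitzWith K γ ∧ IsOpen U ∧ p ∈ U ∧
      ∀ x ∈ U, x ∈ Ω ↔ γ ((ℝ ∙ e)ᗮ.orthogonalProjectionOnto x) < ⟪e, x⟫

/-- A bounded connected Lipschitz domain. -/
structure IsBoundedLipschitzDomain {n : ℕ} (Ω : Set (Space n)) : Prop where
  isOpen : IsOpen Ω
  isConnected : IsConnected Ω
  isBounded : Bornology.IsBounded Ω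
  lipschitz : HasLipschitzBoundary Ω

/-- `G` is a weak (distributional) gradient of `v` on `Ω`, tested against `C_c^∞(Ω)` and in every
direction `e`. -/
def IsWeakGradient {n : ℕ} (Ω : Set (Space n)) (v : Space n → ℝ) (G : Space n → Space n) : Prop :=
  ∀ φ : Space n → ℝ, ContDiff ℝ ∞ φ → HasCompactSupport φ → tsupport φ ⊆ Ω →
    ∀ e : Space n, ∫ x in Ω, v x * fderiv ℝ φ x e = -∫ x in Ω, ⟪G x, e⟫ * φ x

/-- `v ∈ H¹(Ω)`, with weak gradient `G`. -/
structure IsH1 {n : ℕ} (Ω : Set (Space n)) (v : Space n → ℝ) (G : Space n → Space n) : Prop where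
  memLp : MemLp v 2 (volume.restrict Ω)
  memLp_grad : MemLp G 2 (volume.restrict Ω)
  isWeakGradient : IsWeakGradient Ω v G

/-- The `(n-1)`-dimensional surface measure. -/
def surfaceMeasure (n : ℕ) : Measure (Space n) := Measure.hausdorffMeasure ((n : ℝ) - 1)

/-- `g` is the boundary trace on `∂Ω` of the function `v ∈ H¹(Ω)` with weak gradient `G`. The trace
operator `H¹(Ω) → L²(∂Ω)` is the continuous extension of the restriction `φ ↦ φ|_∂Ω` of functions
`φ ∈ H¹(Ω) ∩ C(Ω̄)`: there are such `φ k` with `φ k → v` in `H¹(Ω)` and `φ k|_∂Ω → g` in `L²(∂Ω)`.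
(As `∂Ω` is compact with finite surface measure, the latter forces `g ∈ L²(∂Ω)`.) -/
def IsTrace {n : ℕ} (Ω : Set (Space n)) (v : Space n → ℝ) (G : Space n → Space n)
    (g : Space n → ℝ) : Prop :=
  ∃ (φ : ℕ → Space n → ℝ) (Φ : ℕ → Space n → Space n),
    (∀ k, IsH1 Ω (φ k) (Φ k) ∧ ContinuousOn (φ k) (closure Ω)) ∧
    Tendsto (fun k => eLpNorm (φ k - v) 2 (volume.restrict Ω)) atTop (𝓝 0) ∧
    Tendsto (fun k => eLpNorm (Φ k - G) 2 (volume.restrict Ω)) atTop (𝓝 0) ∧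
    Tendsto (fun k => eLpNorm (φ k - g) 2 ((surfaceMeasure n).restrict (frontier Ω)))
      atTop (𝓝 0)

/-- `v`, with weak gradient `G`, belongs to `H¹_{0,Γ}(Ω)`: it is in `H¹(Ω)` and its trace vanishes
almost everywhere on `Γ`. -/
def IsH1Zero {n : ℕ} (Ω Γ : Set (Space n)) (v : Space n → ℝ) (G : Space n → Space n) : Prop :=
  IsH1 Ω v G ∧ ∃ g : Space n → ℝ, IsTrace Ω v G g ∧ ∀ᵐ x ∂(surfaceMeasure n).restrict Γ, g x = 0

/-- `σ ∈ L^∞_+(Ω)`. -/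
def IsConductivity {n : ℕ} (Ω : Set (Space n)) (σ : Space n → ℝ) : Prop :=
  AEStronglyMeasurable σ (volume.restrict Ω) ∧
    ∃ l : ℝ, 0 < l ∧ l < 1 ∧ ∀ᵐ x ∂volume.restrict Ω, l ≤ σ x ∧ σ x ≤ l⁻¹

/-- `u ∈ H¹(Ω)` is a weak solution of `-∇·(σ∇u) = 0` in `Ω`, `σ ∂_ν u = 0` on `∂Ω \ Γ`:
`∫_Ω σ ∇u·∇v = 0` for all `v ∈ H¹_{0,Γ}(Ω)`. The Dirichlet datum on `Γ` is the boundary value of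
`u` itself. -/
def IsWeakSolution {n : ℕ} (Ω Γ : Set (Space n)) (σ u : Space n → ℝ) : Prop :=
  ∃ Du : Space n → Space n, IsH1 Ω u Du ∧
    ∀ (v : Space n → ℝ) (Dv : Space n → Space n), IsH1Zero Ω Γ v Dv →
      ∫ x in Ω, σ x * ⟪Du x, Dv x⟫ = 0

end MixedProblem

end

open ContinuousLinearMap MeasureTheory Filter Topology
open scoped ContDiff NNReal RealInnerProductSpace Convolution

noncomputable section

namespace MixedProblem

/-! Test the equation with `F ∘ u`, where `F` is `C¹`, nondecreasing and zero on the values `u`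
takes on `Γ`. Being continuous up to the boundary, `F ∘ u` is its own trace, so it is admissible,
and `∫ σ F'(u) |∇u|² = 0`. The integrand is nonnegative, hence `F'(u) ∇u`, the weak gradient of `F ∘
u`, vanishes a.e. Connectedness makes `F ∘ u` constant, and continuity up to `Γ` makes the constant
zero (`IsWeakSolution.comp_eq_zero`). Choosing `F` to vanish exactly on a half-line with endpoint
`c` turns a bound by `c` on `Γ` into one in `Ω`. The analytic input is the chain rule
`IsWeakGradient.comp` and the constancy result `IsWeakGradient.eq_of_ae_eq_zero`, both obtained by
mollification. -/

variable {n : ℕ} {Ω : Set (Space n)} {u : Space n → ℝ} {G : Space n → Space n}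

/-! ### Mollification -/

/-- The mollification of `f` by the normalised bump function `ρ`. -/
def mollify (ρ : ContDiffBump (0 : Space n)) (f : Space n → ℝ) : Space n → ℝ :=
  ρ.normed volume ⋆[lsmul ℝ ℝ, volume] f

lemma mollify_apply (ρ : ContDiffBump (0 : Space n)) (f : Space n → ℝ) (x : Space n) :
    mollify ρ f x = ∫ y, f y * ρ.normed volume (x - y) := by
  simp [mollify, convolution_lsmul_swap, mul_comm]

/-- The kernel is a probability density, so averaging preserves bounds. This keeps mollifications in
the interval where `F` and `F'` are bounded. -/
lemma abs_mollify_le (ρ : ContDiffBump (0 : Space n)) {f : Space n → ℝ} {C : ℝ}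
    (hf : AEStronglyMeasurable f volume) (hC : ∀ x, |f x| ≤ C) (x : Space n) :
    |mollify ρ f x| ≤ C := by
  have := dist_convolution_le (μ := volume) (f := ρ.normed volume) (x₀ := x) (z₀ := (0 : ℝ))
    (R := ρ.rOut) ((abs_nonneg _).trans (hC 0)) ρ.support_normed_eq.subset ρ.nonneg_normed
    ρ.integral_normed hf (fun y _ => by simpa using hC y)
  simpa [mollify] using this

lemma contDiff_mollify (ρ : ContDiffBump (0 : Space n)) {f : Space n → ℝ}
    (hf : LocallyIntegrable f volume) : ContDiff ℝ 1 (mollify ρ f) :=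
  ρ.hasCompactSupport_normed.contDiff_convolution_left _ ρ.contDiff_normed hf

lemma fderiv_mollify (ρ : ContDiffBump (0 : Space n)) {f : Space n → ℝ}
    (hf : LocallyIntegrable f volume) (x e : Space n) :
    fderiv ℝ (mollify ρ f) x e = ∫ y, f y * fderiv ℝ (ρ.normed volume) (x - y) e := by
  have hρ : ContDiff ℝ 1 (ρ.normed (volume : Measure (Space n))) := ρ.contDiff_normed
  have hc : HasCompactSupport (ρ.normed (volume : Measure (Space n))) := ρ.hasCompactSupport_normed
  have h := hc.hasFDerivAt_convolution_right (lsmul ℝ ℝ).flip hf hρ x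
  rw [convolution_flip] at h
  rw [mollify, h.fderiv, convolution_precompR_apply _ hf (hc.fderiv ℝ)
    (hρ.continuous_fderiv one_ne_zero)]
  simp [convolution_def, mul_comm]

/-- Differentiation commutes with mollification, away from the boundary. -/
lemma IsWeakGradient.fderiv_mollify_eq (hG : IsWeakGradient Ω u G) (hΩ : IsOpen Ω)
    (hu : IntegrableOn u Ω) (ρ : ContDiffBump (0 : Space n)) {x : Space n}
    (hx : Metric.closedBall x ρ.rOut ⊆ Ω) (e : Space n) :
    fderiv ℝ (mollify ρ (Ω.indicator u)) x e
      = mollify ρ (Ω.indicator fun y => ⟪G y, e⟫) x := by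
  have hρ : ContDiff ℝ ∞ (ρ.normed (volume : Measure (Space n))) := ρ.contDiff_normed
  have hts : tsupport (fun y => ρ.normed volume (x - y)) ⊆ Metric.closedBall x ρ.rOut := by
    refine closure_minimal (fun y hy => ?_) Metric.isClosed_closedBall
    have : x - y ∈ Function.support (ρ.normed (volume : Measure (Space n))) := hy
    rw [ρ.support_normed_eq, mem_ball_zero_iff] at this
    rw [mem_closedBall_iff_norm']
    exact this.le
  have hderiv (y : Space n) : fderiv ℝ (fun y => ρ.normed volume (x - y)) y e
      = -fderiv ℝ (ρ.normed volume) (x - y) e := by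
    have h1 : HasFDerivAt (ρ.normed volume) (fderiv ℝ (ρ.normed volume) (x - y)) (x - y) :=
      (hρ.differentiable (by simp) _).hasFDerivAt
    have h2 : HasFDerivAt (fun y : Space n => x - y) (-ContinuousLinearMap.id ℝ (Space n)) y :=
      (hasFDerivAt_id y).const_sub x
    have h3 := h1.comp y h2
    rw [Function.comp_def] at h3
    rw [h3.fderiv]
    simp
  -- The test function is the reflected kernel; the sign from reflection cancels the one in the
  -- definition of weak gradient.
  have key := hG (fun y => ρ.normed volume (x - y)) (hρ.comp (contDiff_const.sub contDiff_id))
    ((isCompact_closedBall x ρ.rOut).of_isClosed_subset (isClosed_tsupport _) hts)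
    (hts.trans hx) e
  simp only [hderiv, mul_neg, integral_neg, neg_inj] at key
  rw [fderiv_mollify ρ ((integrable_indicator_iff hΩ.measurableSet).2 hu).locallyIntegrable,
    mollify_apply]
  rw [← integral_indicator hΩ.measurableSet, ← integral_indicator hΩ.measurableSet] at key
  simpa only [Set.indicator_mul_left] using key

/-- A sequence of bump functions shrinking to the origin. -/
def bump (n k : ℕ) : ContDiffBump (0 : Space n) where
  rIn := 1 / (k + 1) / 2
  rOut := 1 / (k + 1)
  rIn_pos := by positivity
  rIn_lt_rOut := half_lt_self (by positivity)

lemma tendsto_rOut_bump (n : ℕ) : Tendsto (fun k => (bump n k).rOut) atTop (𝓝 0) :=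
  tendsto_one_div_add_atTop_nhds_zero_nat

/-- The function may vary with `k`: the chain rule mollifies a sequence that itself depends on `k`.
-/
lemma tendsto_mollify_bump {f : ℕ → Space n → ℝ} (hf : ∀ k, AEStronglyMeasurable (f k) volume)
    {x : Space n} {z : ℝ} (h : Tendsto (Function.uncurry f) (atTop ×ˢ 𝓝 x) (𝓝 z)) :
    Tendsto (Function.uncurry fun k => mollify (bump n k) (f k)) (atTop ×ˢ 𝓝 x) (𝓝 z) := by
  refine ContDiffBump.convolution_tendsto_right (ι := ℕ × Space n) (x₀ := x)
    (φ := fun p => bump n p.1) (g := fun p => f p.1) (k := Prod.snd)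
    ((tendsto_rOut_bump n).comp tendsto_fst) (.of_forall fun p => hf _) ?_ tendsto_snd
  exact h.comp ((tendsto_fst.comp tendsto_fst).prodMk tendsto_snd)

lemma tendsto_mollify_bump_indicator (hΩ : IsOpen Ω) (hu : IntegrableOn u Ω)
    (hc : ContinuousOn u Ω) {x : Space n} (hx : x ∈ Ω) :
    Tendsto (Function.uncurry fun k => mollify (bump n k) (Ω.indicator u)) (atTop ×ˢ 𝓝 x)
      (𝓝 (u x)) := by
  refine tendsto_mollify_bump
    (fun _ => ((integrable_indicator_iff hΩ.measurableSet).2 hu).aestronglyMeasurable) ?_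
  have h : Tendsto (Ω.indicator u) (𝓝 x) (𝓝 (u x)) :=
    (hc.continuousAt (hΩ.mem_nhds hx)).tendsto.congr' <| by
      filter_upwards [hΩ.mem_nhds hx] with y hy using (Set.indicator_of_mem hy u).symm
  exact h.comp tendsto_snd

lemma tendsto_const_prodMk_atTop_nhds (x : Space n) :
    Tendsto (fun k : ℕ => (k, x)) atTop (atTop ×ˢ 𝓝 x) :=
  tendsto_id.prodMk tendsto_const_nhds

/-! ### Functions with zero weak gradient -/

/-- A continuous function with vanishing weak gradient on a connected open set is constant. -/
lemma IsWeakGradient.eq_of_ae_eq_zero (hG : IsWeakGradient Ω u G) (hΩ : IsOpen Ω)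
    (hconn : IsPreconnected Ω) (hu : IntegrableOn u Ω) (hc : ContinuousOn u Ω)
    (hG0 : ∀ᵐ x ∂volume.restrict Ω, G x = 0) {x y : Space n} (hx : x ∈ Ω) (hy : y ∈ Ω) :
    u x = u y := by
  -- On a half-radius ball, mollifications at scale below `r / 2` see only `Ω`, so their derivative
  -- is zero; the limit is locally constant.
  have hloc : ∀ z ∈ Ω, ∀ᶠ w in 𝓝 z, u w = u z := by
    intro z hz
    obtain ⟨r, hr, hrΩ⟩ := Metric.isOpen_iff.1 hΩ z hz
    filter_upwards [Metric.ball_mem_nhds z (half_pos hr)] with w hw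
    have hzw : ∀ᶠ k in atTop, mollify (bump n k) (Ω.indicator u) w
        = mollify (bump n k) (Ω.indicator u) z := by
      filter_upwards [(tendsto_rOut_bump n).eventually_lt_const (half_pos hr)] with k hk
      refine Metric.isOpen_ball.is_const_of_fderiv_eq_zero (𝕜 := ℝ)
        (convex_ball z (r / 2)).isPreconnected
        ((contDiff_mollify _ ((integrable_indicator_iff hΩ.measurableSet).2
          hu).locallyIntegrable).differentiable one_ne_zero).differentiableOn
        (fun p hp => ?_) hw (Metric.mem_ball_self (half_pos hr))
      ext e
      have hsub : Metric.closedBall p (bump n k).rOut ⊆ Ω := by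
        refine (Metric.closedBall_subset_ball' ?_).trans hrΩ
        rw [Metric.mem_ball] at hp
        linarith
      rw [hG.fderiv_mollify_eq hΩ hu _ hsub, mollify_apply]
      have : ∀ᵐ y, Ω.indicator (fun y => ⟪G y, e⟫) y = 0 := by
        filter_upwards [(ae_restrict_iff' hΩ.measurableSet).1 hG0] with y hy
        by_cases hyΩ : y ∈ Ω
        · simp [hyΩ, hy hyΩ]
        · simp [hyΩ]
      simpa using integral_eq_zero_of_ae (this.mono fun y hy => by simp [hy])
    have hwΩ : w ∈ Ω := hrΩ (Metric.ball_subset_ball (by linarith) hw)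
    have h1 := (tendsto_mollify_bump_indicator hΩ hu hc hwΩ).comp (tendsto_const_prodMk_atTop_nhds w)
    have h2 := (tendsto_mollify_bump_indicator hΩ hu hc hz).comp (tendsto_const_prodMk_atTop_nhds z)
    exact tendsto_nhds_unique (h1.congr' hzw) h2
  have hd : ∀ z ∈ Ω, HasFDerivAt u (0 : Space n →L[ℝ] ℝ) z := fun z hz =>
    (hasFDerivAt_const (u z) z).congr_of_eventuallyEq (hloc z hz)
  exact hΩ.is_const_of_fderiv_eq_zero hconn
    (fun z hz => (hd z hz).differentiableAt.differentiableWithinAt)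
    (fun z hz => (hd z hz).fderiv) hx hy

/-! ### The chain rule -/

/-- Mollification is self-adjoint. -/
lemma integral_mul_mollify (ρ : ContDiffBump (0 : Space n)) {f g : Space n → ℝ}
    (hf : Integrable f volume) (hg : Integrable g volume) :
    ∫ x, f x * mollify ρ g x = ∫ x, g x * mollify ρ f x := by
  obtain ⟨C, hC⟩ := ρ.hasCompactSupport_normed.exists_bound_of_continuous
    (ρ.continuous_normed (μ := volume))
  have hint : Integrable (Function.uncurry fun x y => f x * (g y * ρ.normed volume (x - y)))
      (volume.prod volume) := by
    have h := (hf.mul_prod hg).mul_bdd (c := C)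
      (g := fun p : Space n × Space n => ρ.normed volume (p.1 - p.2))
      (ρ.continuous_normed.comp (continuous_fst.sub continuous_snd)).aestronglyMeasurable
      (.of_forall fun p => hC _)
    refine h.congr (.of_forall fun p => ?_)
    simp only [Function.uncurry]
    ring
  simp only [mollify_apply, ← integral_const_mul]
  rw [integral_integral_swap hint]
  refine integral_congr_ae (.of_forall fun y => integral_congr_ae (.of_forall fun x => ?_))
  simp only
  -- The kernel is even.
  rw [← neg_sub y x, ρ.normed_neg]
  ring

/-- Chain rule for the composition of a bounded continuous function that has a weak gradient with a
function of class `C¹`. -/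
lemma IsWeakGradient.comp (hG : IsWeakGradient Ω u G) (hΩ : IsOpen Ω)
    (hu : IntegrableOn u Ω) (hGi : IntegrableOn G Ω) (hc : ContinuousOn u Ω)
    {M : ℝ} (hM0 : 0 ≤ M) (hM : ∀ x ∈ Ω, |u x| ≤ M) {F : ℝ → ℝ} (hF : ContDiff ℝ 1 F) :
    IsWeakGradient Ω (fun x => F (u x)) (fun x => deriv F (u x) • G x) := by
  intro φ hφ hφc hφΩ e
  have hF' : Continuous (deriv F) := hF.continuous_deriv le_rfl
  have hφ1 : Continuous φ := hφ.continuous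
  have hdφ : Continuous fun x => fderiv ℝ φ x e :=
    (hφ.continuous_fderiv (by simp)).clm_apply continuous_const
  have hdφc : HasCompactSupport fun x => fderiv ℝ φ x e := hφc.fderiv_apply ℝ e
  obtain ⟨A, hA⟩ := (isCompact_Icc (a := -M) (b := M)).exists_bound_of_continuousOn
    hF.continuous.continuousOn
  obtain ⟨B, hB⟩ := (isCompact_Icc (a := -M) (b := M)).exists_bound_of_continuousOn
    hF'.continuousOn
  obtain ⟨D, hD⟩ := hφc.exists_bound_of_continuous hφ1
  have hui : Integrable (Ω.indicator u) volume := (integrable_indicator_iff hΩ.measurableSet).2 hu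
  set w : ℕ → Space n → ℝ := fun k => mollify (bump n k) (Ω.indicator u) with hw
  have hwC (k : ℕ) : ContDiff ℝ 1 (w k) := contDiff_mollify _ hui.locallyIntegrable
  have hwM (k : ℕ) (x : Space n) : w k x ∈ Set.Icc (-M) M := by
    refine abs_le.1 (abs_mollify_le _ hui.aestronglyMeasurable (fun y => ?_) x)
    by_cases hy : y ∈ Ω
    · simpa [hy] using hM y hy
    · simpa [hy] using hM0
  set g : Space n → ℝ := fun x => ⟪G x, e⟫ with hg
  have hgi : IntegrableOn g Ω := hGi.inner_const e
  have hgi' : Integrable (Ω.indicator g) volume := (integrable_indicator_iff hΩ.measurableSet).2 hgi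
  -- Self-adjointness moves the mollifier from `g`, which is merely integrable, onto `ψ k`, which is
  -- bounded by `B * D` and converges pointwise in `Ω`. Dominated convergence then applies with
  -- `|g|` in the majorant.
  set ψ : ℕ → Space n → ℝ := fun k x => deriv F (w k x) * φ x with hψ
  have hψc (k : ℕ) : Continuous (ψ k) := (hF'.comp (hwC k).continuous).mul hφ1
  have hψi (k : ℕ) : Integrable (ψ k) volume :=
    (hψc k).integrable_of_hasCompactSupport hφc.mul_left
  have hψB (k : ℕ) (x : Space n) : |ψ k x| ≤ B * D := by
    rw [hψ, abs_mul]
    exact mul_le_mul (hB _ (hwM k x)) (hD x) (abs_nonneg _)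
      ((norm_nonneg _).trans (hB _ (hwM k x)))
  have hwt {x : Space n} (hx : x ∈ Ω) : Tendsto (Function.uncurry w) (atTop ×ˢ 𝓝 x) (𝓝 (u x)) :=
    tendsto_mollify_bump_indicator hΩ hu hc hx
  -- Below scale `δ`, kernels centred anywhere on the support of `φ` stay inside `Ω`.
  obtain ⟨δ, hδ, hδΩ⟩ := hφc.isCompact.exists_cthickening_subset_open hΩ hφΩ
  have hparts : ∀ᶠ k in atTop, ∫ x in Ω, F (w k x) * fderiv ℝ φ x e
      = -∫ x in Ω, g x * mollify (bump n k) (ψ k) x := by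
    filter_upwards [(tendsto_rOut_bump n).eventually_lt_const hδ] with k hk
    have hFw : ContDiff ℝ 1 (fun x => F (w k x)) := hF.comp (hwC k)
    have hdFw : Continuous fun x => fderiv ℝ (fun x => F (w k x)) x e :=
      (hFw.continuous_fderiv one_ne_zero).clm_apply continuous_const
    have h1 : ∫ x in Ω, F (w k x) * fderiv ℝ φ x e = ∫ x, F (w k x) * fderiv ℝ φ x e := by
      refine setIntegral_eq_integral_of_forall_compl_eq_zero fun x hx => ?_
      have : fderiv ℝ φ x = 0 :=
        image_eq_zero_of_notMem_tsupport fun h => hx (hφΩ (tsupport_fderiv_subset ℝ h))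
      simp [this]
    rw [h1, integral_mul_fderiv_eq_neg_fderiv_mul_of_integrable
      ((hdFw.mul hφ1).integrable_of_hasCompactSupport hφc.mul_left)
      ((hFw.continuous.mul hdφ).integrable_of_hasCompactSupport hdφc.mul_left)
      ((hFw.continuous.mul hφ1).integrable_of_hasCompactSupport hφc.mul_left)
      (fun x _ => hFw.differentiable one_ne_zero x)
      (fun x _ => hφ.differentiable (by simp) x)]
    have h2 : ∀ x, fderiv ℝ (fun x => F (w k x)) x e * φ x
        = ψ k x * mollify (bump n k) (Ω.indicator g) x := by
      intro x
      by_cases hx : x ∈ tsupport φ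
      · have hsub : Metric.closedBall x (bump n k).rOut ⊆ Ω :=
          (Metric.closedBall_subset_closedBall hk.le).trans
            ((Metric.closedBall_subset_cthickening hx δ).trans hδΩ)
        have hd : HasFDerivAt (fun x => F (w k x)) (deriv F (w k x) • fderiv ℝ (w k) x) x :=
          ((hF.differentiable one_ne_zero _).hasDerivAt).comp_hasFDerivAt x
            ((hwC k).differentiable one_ne_zero x).hasFDerivAt
        rw [hd.fderiv, ← hG.fderiv_mollify_eq hΩ hu _ hsub]
        simp only [hψ, FunLike.coe_smul, Pi.smul_apply, smul_eq_mul]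
        ring
      · simp [hψ, image_eq_zero_of_notMem_tsupport hx]
    simp only [h2]
    rw [integral_mul_mollify _ (hψi k) hgi', ← integral_indicator hΩ.measurableSet]
    simp only [Set.indicator_mul_left]
  have hL : Tendsto (fun k => ∫ x in Ω, F (w k x) * fderiv ℝ φ x e) atTop
      (𝓝 (∫ x in Ω, F (u x) * fderiv ℝ φ x e)) := by
    refine tendsto_integral_of_dominated_convergence (fun x => A * |fderiv ℝ φ x e|)
      (fun k => ((hF.continuous.comp (hwC k).continuous).mul hdφ).aestronglyMeasurable)
      (((hdφ.integrable_of_hasCompactSupport hdφc).abs.const_mul A).integrableOn) ?_ ?_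
    · refine fun k => .of_forall fun x => ?_
      rw [norm_mul]
      exact mul_le_mul_of_nonneg_right (hA _ (hwM k x)) (norm_nonneg _)
    · filter_upwards [ae_restrict_mem hΩ.measurableSet] with x hx
      exact ((hF.continuous.tendsto _).comp
        ((hwt hx).comp (tendsto_const_prodMk_atTop_nhds x))).mul_const _
  have hR : Tendsto (fun k => ∫ x in Ω, g x * mollify (bump n k) (ψ k) x) atTop
      (𝓝 (∫ x in Ω, g x * (deriv F (u x) * φ x))) := by
    refine tendsto_integral_of_dominated_convergence (fun x => |g x| * (B * D))
      (fun k => hgi.aestronglyMeasurable.mul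
        (contDiff_mollify _ (hψi k).locallyIntegrable).continuous.aestronglyMeasurable)
      (hgi.abs.mul_const _) ?_ ?_
    · refine fun k => .of_forall fun x => ?_
      rw [norm_mul]
      exact mul_le_mul_of_nonneg_left
        (abs_mollify_le _ (hψc k).aestronglyMeasurable (hψB k) x) (norm_nonneg _)
    · filter_upwards [ae_restrict_mem hΩ.measurableSet] with x hx
      have hψt : Tendsto (Function.uncurry ψ) (atTop ×ˢ 𝓝 x) (𝓝 (deriv F (u x) * φ x)) :=
        ((hF'.tendsto _).comp (hwt hx)).mul ((hφ1.tendsto x).comp tendsto_snd)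
      exact ((tendsto_mollify_bump (fun k => (hψc k).aestronglyMeasurable) hψt).comp
        (tendsto_const_prodMk_atTop_nhds x)).const_mul _
  rw [tendsto_nhds_unique (hL.congr' hparts) hR.neg]
  congr 1
  refine integral_congr_ae (.of_forall fun x => ?_)
  simp only [hg, real_inner_smul_left]
  ring

lemma IsH1.comp (h : IsH1 Ω u G) (hΩ : IsOpen Ω) (hb : Bornology.IsBounded Ω)
    (hc : ContinuousOn u (closure Ω)) {F : ℝ → ℝ} (hF : ContDiff ℝ 1 F) :
    IsH1 Ω (fun x => F (u x)) (fun x => deriv F (u x) • G x) := by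
  have : IsFiniteMeasure (volume.restrict Ω) := ⟨by simpa using hb.measure_lt_top⟩
  have hcΩ : ContinuousOn u Ω := hc.mono subset_closure
  have hF' : Continuous (deriv F) := hF.continuous_deriv le_rfl
  obtain ⟨M, hM⟩ := hb.isCompact_closure.exists_bound_of_continuousOn hc
  obtain ⟨A, hA⟩ := hb.isCompact_closure.exists_bound_of_continuousOn
    (hF.continuous.comp_continuousOn hc)
  obtain ⟨B, hB⟩ := hb.isCompact_closure.exists_bound_of_continuousOn (hF'.comp_continuousOn hc)
  refine ⟨.of_bound ((hF.continuous.comp_continuousOn hcΩ).aestronglyMeasurable hΩ.measurableSet)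
    A ?_, h.memLp_grad.of_le_mul (c := B) (((hF'.comp_continuousOn hcΩ).aestronglyMeasurable
      hΩ.measurableSet).smul h.memLp_grad.aestronglyMeasurable) ?_, ?_⟩
  · filter_upwards [ae_restrict_mem hΩ.measurableSet] with x hx using hA x (subset_closure hx)
  · filter_upwards [ae_restrict_mem hΩ.measurableSet] with x hx
    rw [norm_smul]
    exact mul_le_mul_of_nonneg_right (hB x (subset_closure hx)) (norm_nonneg _)
  · exact h.isWeakGradient.comp hΩ (h.memLp.integrable one_le_two)
      (h.memLp_grad.integrable one_le_two) hcΩ (abs_nonneg M)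
      (fun x hx => (hM x (subset_closure hx)).trans (le_abs_self M)) hF

/-- A function in `H¹(Ω) ∩ C(Ω̄)` is its own trace. -/
lemma IsH1.isTrace (h : IsH1 Ω u G) (hc : ContinuousOn u (closure Ω)) : IsTrace Ω u G u :=
  ⟨fun _ => u, fun _ => G, fun _ => ⟨h, hc⟩, by simp, by simp, by simp⟩

/-! ### Testing the equation -/

/-- If `F` is nondecreasing and `F ∘ u` vanishes on `Γ`, then testing the equation with `F ∘ u` shows
that `F ∘ u` vanishes in `Ω`. -/
lemma IsWeakSolution.comp_eq_zero {Γ : Set (Space n)} {σ : Space n → ℝ}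
    (hu : IsWeakSolution Ω Γ σ u) (hΩ : IsOpen Ω) (hconn : IsPreconnected Ω)
    (hb : Bornology.IsBounded Ω) (hΓ_sub : Γ ⊆ closure Ω) (hΓ_meas : MeasurableSet Γ)
    (hΓ_ne : Γ.Nonempty) (hσ : IsConductivity Ω σ) (hc : ContinuousOn u (closure Ω))
    {F : ℝ → ℝ} (hF : ContDiff ℝ 1 F) (hmono : Monotone F) (hF0 : ∀ y ∈ Γ, F (u y) = 0)
    {x : Space n} (hx : x ∈ Ω) : F (u x) = 0 := by
  have : IsFiniteMeasure (volume.restrict Ω) := ⟨by simpa using hb.measure_lt_top⟩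
  obtain ⟨Du, hDu, hsol⟩ := hu
  obtain ⟨hσm, l, hl0, -, hl⟩ := hσ
  have hv := hDu.comp hΩ hb hc hF
  have hvc : ContinuousOn (fun x => F (u x)) (closure Ω) := hF.continuous.comp_continuousOn hc
  have hzero := hsol _ _ ⟨hv, _, hv.isTrace hvc, ae_restrict_of_forall_mem hΓ_meas hF0⟩
  have hint : Integrable (fun x => σ x * ⟪Du x, deriv F (u x) • Du x⟫) (volume.restrict Ω) := by
    have hinner : Integrable (fun x => ⟪Du x, deriv F (u x) • Du x⟫) (volume.restrict Ω) :=
      (hDu.memLp_grad.norm.integrable_mul hv.memLp_grad.norm).mono'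
        (hDu.memLp_grad.aestronglyMeasurable.inner hv.memLp_grad.aestronglyMeasurable)
        (.of_forall fun x => norm_inner_le_norm _ _)
    refine hinner.bdd_mul (c := l⁻¹) hσm ?_
    filter_upwards [hl] with x hx
    rw [Real.norm_of_nonneg (hl0.le.trans hx.1)]
    exact hx.2
  have hnn : 0 ≤ᵐ[volume.restrict Ω] fun x => σ x * ⟪Du x, deriv F (u x) • Du x⟫ := by
    filter_upwards [hl] with x hx
    rw [real_inner_smul_right]
    exact mul_nonneg (hl0.le.trans hx.1) (mul_nonneg hmono.deriv_nonneg real_inner_self_nonneg)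
  have hgrad : ∀ᵐ x ∂volume.restrict Ω, deriv F (u x) • Du x = 0 := by
    filter_upwards [(integral_eq_zero_iff_of_nonneg_ae hnn hint).1 hzero, hl] with x hx hlx
    have hσx : σ x ≠ 0 := (hl0.trans_le hlx.1).ne'
    rw [real_inner_smul_right] at hx
    simpa [hσx] using hx
  obtain ⟨y, hy⟩ := hΓ_ne
  -- The constancy must reach the closure, where `Γ` lies.
  have hconst : Set.EqOn (fun z => F (u z)) (fun _ => F (u x)) (closure Ω) :=
    Set.EqOn.of_subset_closure (fun z hz => hv.isWeakGradient.eq_of_ae_eq_zero hΩ hconn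
      (hv.memLp.integrable one_le_two) (hvc.mono subset_closure) hgrad hz hx)
      hvc continuousOn_const subset_closure subset_rfl
  rw [← hF0 y hy]
  exact (hconst (hΓ_sub hy)).symm

end MixedProblem

end

theorem theoremB1 {n : ℕ} (Ω Γ : Set (MixedProblem.Space n))
    (hΩ : MixedProblem.IsBoundedLipschitzDomain Ω)
    (hΓ_sub : Γ ⊆ frontier Ω)
    (hΓ_open : ∃ U : Set (MixedProblem.Space n), IsOpen U ∧ Γ = U ∩ frontier Ω)
    (hΓ_ne : Γ.Nonempty)
    (σ : MixedProblem.Space n → ℝ) (hσ : MixedProblem.IsConductivity Ω σ)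
    (u : MixedProblem.Space n → ℝ) (hu_cont : ContinuousOn u (closure Ω))
    (hu : MixedProblem.IsWeakSolution Ω Γ σ u) :
    ((∀ y ∈ Γ, 0 ≤ u y) → ∀ x ∈ Ω, 0 ≤ u x) ∧
      ∀ x ∈ Ω, sInf (u '' Γ) ≤ u x ∧ u x ≤ sSup (u '' Γ) := by
  have hsub : Γ ⊆ closure Ω := hΓ_sub.trans frontier_subset_closure
  have hmeas : MeasurableSet Γ := by
    obtain ⟨U, hU, rfl⟩ := hΓ_open
    exact hU.measurableSet.inter isClosed_frontier.measurableSet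
  have hcomp {F : ℝ → ℝ} (hF : ContDiff ℝ 1 F) (hmono : Monotone F)
      (hF0 : ∀ y ∈ Γ, F (u y) = 0) {x} (hx : x ∈ Ω) : F (u x) = 0 :=
    hu.comp_eq_zero hΩ.isOpen hΩ.isConnected.isPreconnected hΩ.isBounded hsub hmeas hΓ_ne hσ
      hu_cont hF hmono hF0 hx
  have hlower (c : ℝ) (hc : ∀ y ∈ Γ, c ≤ u y) : ∀ x ∈ Ω, c ≤ u x := by
    intro x hx
    -- `expNegInvGlue` is smooth, nondecreasing and zero exactly on `(-∞, 0]`, so this `F` is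
    -- nondecreasing and zero exactly on `[c, ∞)`.
    have h := hcomp (F := fun t => -expNegInvGlue (c - t))
      (expNegInvGlue.contDiff (n := 1) |>.comp (contDiff_const.sub contDiff_id)).neg
      (fun s t hst => neg_le_neg (expNegInvGlue.monotone (sub_le_sub_left hst c)))
      (fun y hy => by simpa using hc y hy) hx
    simpa using h
  have hupper (c : ℝ) (hc : ∀ y ∈ Γ, u y ≤ c) : ∀ x ∈ Ω, u x ≤ c := by
    intro x hx
    have h := hcomp (F := fun t => expNegInvGlue (t - c))
      (expNegInvGlue.contDiff (n := 1) |>.comp (contDiff_id.sub contDiff_const))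
      (fun s t hst => expNegInvGlue.monotone (sub_le_sub_right hst c))
      (fun y hy => by simpa using hc y hy) hx
    simpa using h
  -- Compactness bounds `u '' Γ`, so that `sInf` and `sSup` are genuine bounds rather than default
  -- values.
  have hcpt : IsCompact (u '' closure Ω) :=
    hΩ.isBounded.isCompact_closure.image_of_continuousOn hu_cont
  have himg : u '' Γ ⊆ u '' closure Ω := Set.image_mono hsub
  exact ⟨hlower 0, fun x hx =>
    ⟨hlower _ (fun y hy => csInf_le (hcpt.bddBelow.mono himg) ⟨y, hy, rfl⟩) x hx,
      hupper _ (fun y hy => le_csSup (hcpt.bddAbove.mono himg) ⟨y, hy, rfl⟩) x hx⟩⟩
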